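/- A game consists of a finite directed graph $(V,E)$ (self-loops allowed), a finite set $\Pi$ of players, a partition $(V_i)_{i\in\Pi\cup\{?\}}$ of $V$, an initial vertex $v_0$, for every non-terminal vertex $v\in V_?$ a probability distribution on the out-neighbours of $v$, and a payoff $\mu_i(t)\in[0,1]$ for every player $i$ and every terminal vertex $t$, where a vertex is terminal if it has no outgoing edges. A (stationary) strategy of player $i$ assigns to every non-terminal vertex $v\in V_i$ a probability distribution on the out-neighbours of $v$; a strategy profile $\bar\sigma$ consists of one strategy per player. It induces a probability measure on the plays starting in $v_0$ (paths that are infinite or end in a terminal vertex). The payoff of player $i$ is $\mu_i(t)$ for a play that ends in the terminal vertex $t$ and $0$ for an infinite play; $\mathbb E(\bar\sigma)[\mu_i]$ denotes its expectation. For $\varepsilon>0$ (resp. $\varepsilon=0$), an $\varepsilon$-Nash equilibrium (resp. a Nash equilibrium) is a strategy profile $\bar\sigma$ such that $\mathbb E(\bar\sigma_{-i},\sigma_i')[\mu_i]-\varepsilon\le\mathbb E(\bar\sigma)[\mu_i]$ for every player $i$ and every stationary strategy $\sigma'_i$ of player $i$. Given thresholds $\bar x,\bar y\in\mathbb Q^\Pi$,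 it is called $\varepsilon$-constrained (resp. constrained) if moreover $x_i-\varepsilon\le\mathbb E(\bar\sigma)[\mu_i]\le y_i+\varepsilon$ for every player $i$. For an integer $\ell\ge1$ let $\mathcal F(\ell)=\{m2^e: m\in\{0,\dots,2^\ell-1\},\ e\in\mathbb Z\}$. For a finite set $S$ with $t$ elements, a probability distribution $d$ on $S$ belongs to $\mathcal D(\ell)$ if there are $w_s\in\mathcal F(\ell)$, $s\in S$, with sum $W=\sum_{s\in S}w_s>0$, such that $d(s)=w_s/W$ for all $s\in S$ and $\max\{W,1/W\}-1\le(1-2^{1-\ell})^{-t}-1$. **Lemma.** Consider a game with $n=|V|$ vertices, thresholds $\bar x,\bar y\in\mathbb Q^\Pi$, and an integer $\ell\ge1000n^2$. If there exists a constrained stationary Nash equilibrium, then there exists a $(32n^22^{-\ell})$-constrained stationary Nash equilibrium $\bar\sigma'$ such that for every player $i$ and every non-terminal vertex $v\in V_i$ the distribution $\bar\sigma'(v)$ on the out-neighbours of $v$ belongs to $\mathcal D(\ell)$. -/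

import Mathlib

open MeasureTheory ProbabilityTheory

/-! ## Floating-point numbers and floating-point distributions -/

/-- Floating-point numbers with precision `ℓ`: the reals `m * 2 ^ e` with
`m ∈ {0, …, 2 ^ ℓ - 1}` and `e ∈ ℤ`. -/
def floatNumbers (ℓ : ℕ) : Set ℝ :=
  {x | ∃ (m : ℕ) (e : ℤ), m < 2 ^ ℓ ∧ x = (m : ℝ) * (2 : ℝ) ^ e}

/-- Relative distance of two positive reals. -/
noncomputable def relDist (x y : ℝ) : ℝ := max (x / y) (y / x) - 1

/-- The positive reals `x` and `y` are `(ℓ, i)`-close. -/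
def IsRelClose (ℓ i : ℕ) (x y : ℝ) : Prop :=
  0 < x ∧ 0 < y ∧ relDist x y ≤ (1 - (2 : ℝ) ^ (1 - (ℓ : ℤ))) ^ (-(i : ℤ)) - 1

/-- The set `𝒟(ℓ)` of floating-point probability distributions with precision `ℓ`
on a finite set `S` of outcomes. -/
def floatDistributions (ℓ : ℕ) (S : Type*) [Fintype S] : Set (PMF S) :=
  {d | ∃ w : S → ℝ, (∀ s, w s ∈ floatNumbers ℓ) ∧
    (∀ s, (d s).toReal = w s / ∑ s', w s') ∧
    IsRelClose ℓ (Fintype.card S) (∑ s', w s') 1}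

/-! ## Games, stationary strategies, payoffs -/

/-- A turn-based stochastic multiplayer game with terminal rewards, with vertex set `V` and set
of players `P`. The partition of the vertices is given by `owner`: the value `some i` means that
the vertex is controlled by player `i`, the value `none` that it is stochastic. Who owns a
terminal vertex (a vertex without outgoing edges) is irrelevant: transition probabilities are
given exactly at the stochastic vertices that are not terminal. -/
structure StochasticGame (V P : Type*) where
  /-- The underlying directed graph. -/
  graph : Digraph V
  /-- The partition of the vertices among the players and the random environment. -/
  owner : V → Option P
  /-- The probability function at the stochastic vertices. -/
  prob : (v : {v : V // owner v = none ∧ ∃ w, graph.Adj v w}) → PMF {w : V // graph.Adj v.1 w}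
  /-- The payoff function on the terminal vertices. -/
  payoff : {t : V // ¬ ∃ w, graph.Adj t w} → P → unitInterval
  /-- The initial vertex. -/
  init : V

namespace StochasticGame

variable {V P : Type*}

/-- Terminal vertices are those without outgoing edges. -/
def IsTerminal (G : StochasticGame V P) (v : V) : Prop := ¬ ∃ w, G.graph.Adj v w

/-- The vertices at which player `i` has to choose a successor. -/
abbrev Controlled (G : StochasticGame V P) (i : P) : Type _ :=
  {v : V // G.owner v = some i ∧ ∃ w, G.graph.Adj v w}

/-- The out-neighbours of a vertex. -/
abbrev Neighbors (G : StochasticGame V P) (v : V) : Type _ := {w : V // G.graph.Adj v w}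

/-- A (stationary) strategy of player `i`. -/
abbrev Strategy (G : StochasticGame V P) (i : P) : Type _ :=
  (v : G.Controlled i) → PMF (G.Neighbors v.1)

/-- A (stationary) strategy profile. -/
abbrev Profile (G : StochasticGame V P) : Type _ := (i : P) → G.Strategy i

open Classical in
/-- The profile `(σ₋ᵢ, τ)` in which player `i` deviates to `τ`. -/
noncomputable def deviate (G : StochasticGame V P) (σ : G.Profile) (i : P) (τ : G.Strategy i) :
    G.Profile :=
  Function.update σ i τ

open Classical in
/-- The law of the next vertex under the profile `σ`. A play that has reached a terminal vertex
is over, which is encoded by staying there forever. -/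
noncomputable def step (G : StochasticGame V P) (σ : G.Profile) (v : V) : PMF V :=
  if h : ∃ w, G.graph.Adj v w then
    match ho : G.owner v with
    | none => (G.prob ⟨v, ho, h⟩).map Subtype.val
    | some i => (σ i ⟨v, ho, h⟩).map Subtype.val
  else PMF.pure v

/-- The transition kernel of the process of vertices: the law of the vertex at time `n + 1`, given
the vertices up to time `n`. -/
noncomputable def stepKernel [Countable V] [MeasurableSpace V] [DiscreteMeasurableSpace V]
    (G : StochasticGame V P) (σ : G.Profile) (n : ℕ) :
    Kernel ((k : Finset.Iic n) → V) V :=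
  (Kernel.ofFunOfCountable fun v => (G.step σ v).toMeasure).comap
    (fun h => h ⟨n, Finset.mem_Iic.2 le_rfl⟩) (measurable_pi_apply _)

instance [Countable V] [MeasurableSpace V] [DiscreteMeasurableSpace V]
    (G : StochasticGame V P) (σ : G.Profile) (n : ℕ) : IsMarkovKernel (G.stepKernel σ n) := by
  have : IsMarkovKernel (Kernel.ofFunOfCountable fun v => (G.step σ v).toMeasure) :=
    ⟨fun v => PMF.toMeasure.isProbabilityMeasure (G.step σ v)⟩
  unfold stepKernel
  infer_instance

/-- The probability measure on plays induced by the profile `σ`. Plays are encoded as infinite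
sequences of vertices, a finite play being continued by repeating its last (terminal) vertex. -/
noncomputable def playMeasure [Countable V] [MeasurableSpace V] [DiscreteMeasurableSpace V]
    (G : StochasticGame V P) (σ : G.Profile) : Measure (ℕ → V) :=
  Kernel.trajMeasure (X := fun _ => V) (Measure.dirac G.init) (G.stepKernel σ)

open Classical in
/-- The payoff of player `i` for a play: the payoff of the terminal vertex in which the play ends,
and `0` if no terminal vertex is ever reached. -/
noncomputable def playPayoff (G : StochasticGame V P) (i : P) (ω : ℕ → V) : ℝ :=
  if h : ∃ k, G.IsTerminal (ω k) then (G.payoff ⟨ω (Nat.find h), Nat.find_spec h⟩ i : ℝ) else 0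

/-- The expected payoff of player `i` under the profile `σ`. The countable vertex set carries the
discrete σ-algebra. -/
noncomputable def expectedPayoff [Countable V] (G : StochasticGame V P) (σ : G.Profile) (i : P) :
    ℝ :=
  letI : MeasurableSpace V := ⊤
  ∫ ω, G.playPayoff i ω ∂(G.playMeasure σ)

/-! ## Equilibria -/

/-- (Stationary) Nash equilibrium. -/
def IsNash [Countable V] (G : StochasticGame V P) (σ : G.Profile) : Prop :=
  ∀ (i : P) (τ : G.Strategy i), G.expectedPayoff (G.deviate σ i τ) i ≤ G.expectedPayoff σ i

/-- (Stationary) `ε`-Nash equilibrium. -/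
def IsEpsNash [Countable V] (G : StochasticGame V P) (ε : ℝ) (σ : G.Profile) : Prop :=
  ∀ (i : P) (τ : G.Strategy i), G.expectedPayoff (G.deviate σ i τ) i - ε ≤ G.expectedPayoff σ i

/-- (Stationary) Nash equilibrium that satisfies the payoff constraints `x ≤ · ≤ y`. -/
def IsConstrainedNash [Countable V] (G : StochasticGame V P) (x y : P → ℚ) (σ : G.Profile) :
    Prop :=
  G.IsNash σ ∧ ∀ i, (x i : ℝ) ≤ G.expectedPayoff σ i ∧ G.expectedPayoff σ i ≤ y i

/-- (Stationary) `ε`-Nash equilibrium that satisfies the payoff constraints `x ≤ · ≤ y` up to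
`ε`. -/
def IsEpsConstrainedNash [Countable V] (G : StochasticGame V P) (x y : P → ℚ) (ε : ℝ)
    (σ : G.Profile) : Prop :=
  G.IsEpsNash ε σ ∧ ∀ i, (x i : ℝ) - ε ≤ G.expectedPayoff σ i ∧ G.expectedPayoff σ i ≤ y i + ε

open Classical in
/-- Every distribution used by a player in the profile `σ` is a floating-point distribution with
precision `ℓ`. -/
def IsFloatProfile [Fintype V] (G : StochasticGame V P) (ℓ : ℕ) (σ : G.Profile) : Prop :=
  ∀ (i : P) (v : G.Controlled i), σ i v ∈ floatDistributions ℓ (G.Neighbors v.1)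

end StochasticGame

/-! Round every probability down to `ℓ` significant bits and renormalise; each probability then
changes by a factor of at most `1 / (1 - δ)` in either direction, where `δ = 2 ^ (1 - ℓ)`. What must
be shown is that expected payoffs are robust under such a relative change, however small the
probabilities are. A payoff is the value at the initial vertex of the least superharmonic majorant
of the terminal payoffs (`exists_isLeast_expectedPayoff`). Change the rows of the chain one at a
time. For a non-terminal vertex `s`, let `g` be the payoff collected without visiting `s` and `h`
the probability of visiting `s`. By renewal, the value at `s` is `(P g) s / (1 - (P h) s)` when the
denominator is nonzero. Both numerator and denominator are nonnegative combinations of the entries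
of row `s`, so the quotient changes by a factor of at most `c ^ 2`
(`isLeast_superharmonicMajorants_le_of_row`). With `n` vertices the total factor is `(1 - δ) ^ (-2 *
n)`, so payoffs in `[0, 1]` move by at most `2 * n * δ`. A deviating player keeps the two profiles
close, so the equilibrium inequality loses at most twice this amount. -/

theorem PMF.sum_toReal {S : Type*} [Fintype S] (d : PMF S) : ∑ s, (d s).toReal = 1 := by
  rw [← ENNReal.toReal_sum fun s _ => d.apply_ne_top s, ← tsum_fintype (L := .unconditional S),
    d.tsum_coe, ENNReal.toReal_one]

/-! ### Perturbation of superharmonic majorants of finite Markov chains -/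

section MarkovChain

open Filter Topology Matrix

variable {V : Type*} [Fintype V]

theorem Matrix.mulVec_mono_right {P : Matrix V V ℝ} (hP : ∀ i j, 0 ≤ P i j) {f g : V → ℝ}
    (hfg : f ≤ g) : P *ᵥ f ≤ P *ᵥ g := fun i =>
  Finset.sum_le_sum fun j _ => mul_le_mul_of_nonneg_left (hfg j) (hP i j)

/-- The functions that dominate `r` and are superharmonic for the transition matrix `P`. -/
def superharmonicMajorants (P : Matrix V V ℝ) (r : V → ℝ) : Set (V → ℝ) :=
  {f | r ≤ f ∧ P *ᵥ f ≤ f}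

variable [DecidableEq V]

theorem pow_mulVec_le {P : Matrix V V ℝ} (hP : ∀ i j, 0 ≤ P i j) {r f : V → ℝ}
    (hf : f ∈ superharmonicMajorants P r) (k : ℕ) : (P ^ k) *ᵥ r ≤ f := by
  induction k with
  | zero => simpa using hf.1
  | succ k ih =>
    rw [pow_succ', ← mulVec_mulVec]
    exact (mulVec_mono_right hP ih).trans hf.2

theorem one_mem_superharmonicMajorants {P : Matrix V V ℝ} (hP : P ∈ rowStochastic ℝ V)
    {r : V → ℝ} (hr : r ≤ 1) : 1 ∈ superharmonicMajorants P r :=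
  ⟨hr, hP.2.le⟩

/-- If `r` is subharmonic and bounded by `1`, the iterates `P ^ k *ᵥ r` converge to the least
superharmonic majorant of `r`. -/
theorem exists_isLeast_superharmonicMajorants {P : Matrix V V ℝ} (hP : P ∈ rowStochastic ℝ V)
    {r : V → ℝ} (hr : r ≤ P *ᵥ r) (hr1 : r ≤ 1) :
    ∃ f, IsLeast (superharmonicMajorants P r) f ∧
      Tendsto (fun k => (P ^ k) *ᵥ r) atTop (𝓝 f) := by
  have hP0 := hP.1
  have hmono : Monotone fun k => (P ^ k) *ᵥ r := by
    refine monotone_nat_of_le_succ fun k => ?_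
    induction k with
    | zero => simpa using hr
    | succ k ih =>
      simp only [pow_succ' P (k + 1), pow_succ' P k, ← mulVec_mulVec] at ih ⊢
      exact mulVec_mono_right hP0 ih
  have hbdd : BddAbove (Set.range fun k => (P ^ k) *ᵥ r) :=
    ⟨1, by rintro _ ⟨k, rfl⟩; exact pow_mulVec_le hP0 (one_mem_superharmonicMajorants hP hr1) k⟩
  have ht := tendsto_atTop_ciSup hmono hbdd
  refine ⟨_, ⟨⟨?_, ?_⟩, fun F hF => le_of_tendsto' ht (pow_mulVec_le hP0 hF)⟩, ht⟩
  · simpa using le_ciSup hbdd 0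
  · have h1 : Tendsto (fun k => P *ᵥ ((P ^ k) *ᵥ r)) atTop
        (𝓝 (P *ᵥ (⨆ k, (P ^ k) *ᵥ r))) :=
      ((continuous_const.matrix_mulVec continuous_id).tendsto _).comp ht
    refine le_of_tendsto' h1 fun k => ?_
    rw [mulVec_mulVec, ← pow_succ']
    exact le_ciSup hbdd (k + 1)

/-- Changing a single row of a Markov chain by a factor of at most `c` changes the least
superharmonic majorant by a factor of at most `c ^ 2`. -/
theorem isLeast_superharmonicMajorants_le_of_row {P P' : Matrix V V ℝ}
    (hP : P ∈ rowStochastic ℝ V) (hP' : P' ∈ rowStochastic ℝ V) {r f f' : V → ℝ}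
    (hr0 : 0 ≤ r) (hr1 : r ≤ 1) (hr : r ≤ P *ᵥ r) {s : V} (hs : r s = 0) {c : ℝ} (hc : 1 ≤ c)
    (hne : ∀ v ≠ s, P' v = P v) (hle : ∀ w, P' s w ≤ c * P s w) (hge : ∀ w, P s w ≤ c * P' s w)
    (hf : IsLeast (superharmonicMajorants P r) f)
    (hf' : IsLeast (superharmonicMajorants P' r) f') : f' ≤ c ^ 2 • f := by
  -- `Q` makes `s` absorbing. Below, `g` is the value of `r` for the stopped chain and `h` the
  -- probability of reaching `s`; neither depends on row `s` of `P`.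
  set Q : Matrix V V ℝ := P.updateRow s (Pi.single s 1) with hQ
  have hQs (a : V → ℝ) : (Q *ᵥ a) s = a s := by simp [hQ, mulVec]
  have hQne (a : V → ℝ) {v : V} (hv : v ≠ s) : (Q *ᵥ a) v = (P *ᵥ a) v := by
    simp [hQ, mulVec, hv]
  have hQP : Q ∈ rowStochastic ℝ V := by
    refine ⟨fun i j => ?_, ?_⟩
    · rcases eq_or_ne i s with rfl | hi
      · by_cases hj : j = i <;> simp [hQ, hj]
      · simpa [hQ, hi] using hP.1 i j
    · funext v
      rcases eq_or_ne v s with rfl | hv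
      · rw [hQs]
      · rw [hQne _ hv, hP.2]
  have hφ : 0 ≤ f s := by simpa [hs] using hf.1.1 s
  have he0 : (0 : V → ℝ) ≤ Pi.single s 1 := by simp
  have he1 : (Pi.single s 1 : V → ℝ) ≤ 1 := by
    intro v; by_cases hv : v = s <;> simp [hv]
  have hrQ : r ≤ Q *ᵥ r := by
    intro v
    rcases eq_or_ne v s with rfl | hv
    · rw [hQs]
    · rw [hQne _ hv]; exact hr v
  have heQ : (Pi.single s 1 : V → ℝ) ≤ Q *ᵥ Pi.single s 1 := by
    intro v
    rcases eq_or_ne v s with rfl | hv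
    · rw [hQs]
    · rw [Pi.single_eq_of_ne hv]
      exact Finset.sum_nonneg fun j _ => mul_nonneg (hQP.1 v j) (he0 j)
  obtain ⟨g, hg, hgt⟩ := exists_isLeast_superharmonicMajorants hQP hrQ hr1
  obtain ⟨h, hh, hht⟩ := exists_isLeast_superharmonicMajorants hQP heQ he1
  have hh1 : h ≤ 1 := hh.2 (one_mem_superharmonicMajorants hQP he1)
  have hhs : 1 ≤ h s := by simpa using hh.1.1 s
  -- For the stopped chain, `f` is a superharmonic majorant of `r` plus the reward `f s` placed at
  -- `s`. Only this half of the renewal identity is needed.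
  have hsum : g + f s • h ≤ f := by
    refine le_of_tendsto' (hgt.add (hht.const_smul (f s))) fun k => ?_
    have := pow_mulVec_le (r := r + f s • Pi.single s 1) (f := f) hQP.1 ⟨?_, ?_⟩ k
    · simpa [mulVec_add, mulVec_smul] using this
    · intro v
      rcases eq_or_ne v s with rfl | hv
      · simp [hs]
      · simpa [hv] using hf.1.1 v
    · intro v
      rcases eq_or_ne v s with rfl | hv
      · rw [hQs]
      · rw [hQne _ hv]; exact hf.1.2 v
  have hg0 : 0 ≤ g := hr0.trans hg.1.1
  have hh0 : 0 ≤ h := he0.trans hh.1.1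
  have hcc : 1 ≤ c ^ 2 := one_le_pow₀ hc
  have hgs : g s = 0 := by
    have h1 := hsum s
    have h2 := hg0 s
    simp only [Pi.add_apply, Pi.smul_apply, smul_eq_mul, Pi.zero_apply] at h1 h2
    nlinarith
  have hhs' : h s = 1 := le_antisymm (hh1 s) hhs
  have hmain : (P' *ᵥ g) s ≤ c ^ 2 * f s * (1 - (P' *ᵥ h) s) := by
    -- The escape probability `1 - (R h) s` is itself a nonnegative combination of row `s`, so it
    -- obeys a multiplicative bound too. Keeping it as a factor avoids dividing by a possible zero.
    have hone (R : Matrix V V ℝ) (hR : R ∈ rowStochastic ℝ V) :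
        1 - (R *ᵥ h) s = ∑ w, R s w * (1 - h w) := by
      have := congrFun hR.2 s
      simp only [mulVec, dotProduct, Pi.one_apply, mul_one] at this
      simp [mulVec, dotProduct, mul_sub, this]
    have h1 : (P' *ᵥ g) s ≤ c * (P *ᵥ g) s := by
      simp only [mulVec, dotProduct, Finset.mul_sum, ← mul_assoc]
      exact Finset.sum_le_sum fun w _ => mul_le_mul_of_nonneg_right (hle w) (hg0 w)
    have h2 : 1 - (P *ᵥ h) s ≤ c * (1 - (P' *ᵥ h) s) := by
      rw [hone P hP, hone P' hP', Finset.mul_sum]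
      simp only [← mul_assoc]
      exact Finset.sum_le_sum fun w _ =>
        mul_le_mul_of_nonneg_right (hge w) (sub_nonneg.2 (hh1 w))
    have h3 : (P *ᵥ g) s + f s * (P *ᵥ h) s ≤ f s := by
      have := (mulVec_mono_right hP.1 hsum s).trans (hf.1.2 s)
      simpa [mulVec_add, mulVec_smul] using this
    calc (P' *ᵥ g) s ≤ c * (P *ᵥ g) s := h1
      _ ≤ c * (f s * (1 - (P *ᵥ h) s)) := by gcongr; linarith
      _ ≤ c * (f s * (c * (1 - (P' *ᵥ h) s))) := by gcongr
      _ = _ := by ring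
  -- This guess for the new chain raises the value at `s` from `f s` to `c ^ 2 * f s`; `hmain` is
  -- exactly its superharmonicity at `s`.
  have hF : g + (c ^ 2 * f s) • h ∈ superharmonicMajorants P' r := by
    refine ⟨fun v => (hg.1.1 v).trans ?_, fun v => ?_⟩
    · simpa using mul_nonneg (mul_nonneg (by positivity) hφ) (hh0 v)
    · simp only [mulVec_add, mulVec_smul, Pi.add_apply, Pi.smul_apply, smul_eq_mul]
      rcases eq_or_ne v s with rfl | hv
      · rw [hgs, hhs']; linarith
      · have hrow (a : V → ℝ) : (P' *ᵥ a) v = (Q *ᵥ a) v := by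
          rw [hQne _ hv]; simp only [mulVec, hne v hv]
        rw [hrow, hrow]
        exact add_le_add (hg.1.2 v)
          (mul_le_mul_of_nonneg_left (hh.1.2 v) (mul_nonneg (by positivity) hφ))
  refine (hf'.2 hF).trans fun v => ?_
  have h1 := hsum v
  have h2 := hg0 v
  simp only [Pi.add_apply, Pi.smul_apply, smul_eq_mul, Pi.zero_apply] at h1 h2 ⊢
  nlinarith

/-- Changing the rows of a Markov chain by factors of at most `c` changes the least
superharmonic majorant by a factor of at most `c ^ (2 * card V)`. -/
theorem isLeast_superharmonicMajorants_le {P P' : Matrix V V ℝ}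
    (hP : P ∈ rowStochastic ℝ V) (hP' : P' ∈ rowStochastic ℝ V) {r f f' : V → ℝ}
    (hr0 : 0 ≤ r) (hr1 : r ≤ 1) (hr : r ≤ P *ᵥ r) {c : ℝ} (hc : 1 ≤ c)
    (hrow : ∀ s, P' s = P s ∨
      r s = 0 ∧ (∀ w, P' s w ≤ c * P s w) ∧ ∀ w, P s w ≤ c * P' s w)
    (hf : IsLeast (superharmonicMajorants P r) f)
    (hf' : IsLeast (superharmonicMajorants P' r) f') :
    f' ≤ c ^ (2 * Fintype.card V) • f := by
  -- Hybrid chains interpolate between `P` and `P'`, with the rows in `S` already replaced.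
  let R (S : Finset V) : Matrix V V ℝ := fun v => if v ∈ S then P' v else P v
  have hR (S : Finset V) : R S ∈ rowStochastic ℝ V := by
    refine ⟨fun i j => ?_, funext fun v => ?_⟩
    · by_cases hi : i ∈ S
      · simpa [R, hi] using hP'.1 i j
      · simpa [R, hi] using hP.1 i j
    · by_cases hv : v ∈ S
      · simpa [R, hv, mulVec] using congrFun hP'.2 v
      · simpa [R, hv, mulVec] using congrFun hP.2 v
  have hRr (S : Finset V) : r ≤ R S *ᵥ r := by
    intro v
    rcases hrow v with h | h
    · have : R S v = P v := by simp [R, h]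
      simpa only [mulVec, this] using hr v
    · rw [h.1]
      exact Finset.sum_nonneg fun j _ => mul_nonneg ((hR S).1 v j) (hr0 j)
  have key (S : Finset V) : ∀ a, IsLeast (superharmonicMajorants (R S) r) a →
      a ≤ c ^ (2 * S.card) • f := by
    induction S using Finset.induction_on with
    | empty =>
      intro a ha
      have : R ∅ = P := by funext v; simp [R]
      rw [this] at ha
      simp [ha.unique hf]
    | insert s S hsS ih =>
      intro a ha
      have hne : ∀ v ≠ s, R (insert s S) v = R S v := by
        intro v hv; simp [R, hv]
      have hs' : R (insert s S) s = P' s := by simp [R]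
      have hs : R S s = P s := by simp [R, hsS]
      rw [Finset.card_insert_of_notMem hsS, mul_add, mul_one, add_comm, pow_add, mul_smul]
      rcases hrow s with h | h
      · have : R (insert s S) = R S := by
          funext v
          rcases eq_or_ne v s with rfl | hv
          · rw [hs', hs, h]
          · exact hne v hv
        rw [this] at ha
        refine (ih a ha).trans fun v => ?_
        have h0 : 0 ≤ f v := (hr0 v).trans (hf.1.1 v)
        simp only [Pi.smul_apply, smul_eq_mul]
        exact le_mul_of_one_le_left (mul_nonneg (by positivity) h0) (one_le_pow₀ hc)
      · obtain ⟨b, hb, -⟩ := exists_isLeast_superharmonicMajorants (hR S) (hRr S) hr1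
        refine (isLeast_superharmonicMajorants_le_of_row (hR S) (hR _) hr0 hr1 (hRr S) h.1 hc hne
          (by rw [hs', hs]; exact h.2.1) (by rw [hs', hs]; exact h.2.2) hb ha).trans ?_
        exact smul_le_smul_of_nonneg_left (ih b hb) (by positivity)
  have : R Finset.univ = P' := by funext v; simp [R]
  exact key Finset.univ f' (by rwa [this])

end MarkovChain

/-! ### Rounding to floating-point numbers and distributions -/

section Rounding

theorem exists_floatNumber_approx {ℓ : ℕ} {d : ℝ} (hd : 0 ≤ d) :
    ∃ w ∈ floatNumbers ℓ, 0 ≤ w ∧ (1 - (2 : ℝ) ^ (1 - (ℓ : ℤ))) * d ≤ w ∧ w ≤ d := by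
  rcases hd.eq_or_lt with rfl | hd
  · exact ⟨0, ⟨0, 0, by simp⟩, le_rfl, by simp, le_rfl⟩
  -- With `2 ^ n ≤ d < 2 ^ (n + 1)`, rounding down to a multiple of `2 ^ (n + 1 - ℓ)` leaves a
  -- mantissa below `2 ^ ℓ` and loses at most `2 ^ (1 - ℓ) * d`.
  obtain ⟨n, hn, hn'⟩ := exists_mem_Ico_zpow hd (one_lt_two (α := ℝ))
  have hpos : (0 : ℝ) < 2 ^ (n + (1 - (ℓ : ℤ))) := by positivity
  have hfl := Nat.floor_le (div_nonneg hd.le hpos.le)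
  have hfl' := Nat.lt_floor_add_one (d / (2 : ℝ) ^ (n + (1 - (ℓ : ℤ))))
  rw [le_div_iff₀ hpos] at hfl
  rw [div_lt_iff₀ hpos] at hfl'
  refine ⟨⌊d / (2 : ℝ) ^ (n + (1 - (ℓ : ℤ)))⌋₊ * 2 ^ (n + (1 - (ℓ : ℤ))), ⟨_, _, ?_, rfl⟩,
    by positivity, ?_, hfl⟩
  · rw [Nat.floor_lt (by positivity), div_lt_iff₀ hpos]
    push_cast
    rw [← zpow_natCast, ← zpow_add₀ two_ne_zero]
    convert hn' using 2
    ring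
  · rw [zpow_add₀ two_ne_zero] at hfl' ⊢
    have : (2 : ℝ) ^ n * 2 ^ (1 - (ℓ : ℤ)) ≤ d * 2 ^ (1 - (ℓ : ℤ)) := by gcongr
    linarith

/-- Rounding all weights down keeps their sum `W` in `[1 - u, 1]`. Rounding lowers a weight and
dividing by `W` raises it, each by at most one factor `1 - u`; as they act in opposite directions, a
single factor bounds the change both ways. -/
theorem exists_floatDistribution_approx {ℓ : ℕ} (hℓ : 2 ≤ ℓ) {S : Type*} [Fintype S] (d : PMF S) :
    ∃ d' ∈ floatDistributions ℓ S, ∀ s,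
      (1 - (2 : ℝ) ^ (1 - (ℓ : ℤ))) * (d s).toReal ≤ (d' s).toReal ∧
      (1 - (2 : ℝ) ^ (1 - (ℓ : ℤ))) * (d' s).toReal ≤ (d s).toReal := by
  set u : ℝ := 2 ^ (1 - (ℓ : ℤ)) with hu
  have hu0 : 0 < u := by positivity
  have hu1 : u < 1 := zpow_lt_one_of_neg₀ one_lt_two (by omega)
  have hv : 0 < 1 - u := by linarith
  have hsum := d.sum_toReal
  have hS : Nonempty S := d.support_nonempty.to_type
  choose w hw hw0 hw1 hw2 using fun s => exists_floatNumber_approx (ℓ := ℓ)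
    (ENNReal.toReal_nonneg (a := d s))
  simp only [← hu] at hw1
  have hW1 : 1 - u ≤ ∑ s, w s := by
    calc 1 - u = ∑ s, (1 - u) * (d s).toReal := by rw [← Finset.mul_sum, hsum, mul_one]
      _ ≤ _ := Finset.sum_le_sum fun s _ => hw1 s
  have hW2 : ∑ s, w s ≤ 1 := hsum ▸ Finset.sum_le_sum fun s _ => hw2 s
  have hW : 0 < ∑ s, w s := hv.trans_le hW1
  set W := ∑ s, w s with hWdef
  let d' : PMF S := PMF.ofFintype (fun s => ENNReal.ofReal (w s / W)) (by
    rw [← ENNReal.ofReal_sum_of_nonneg fun s _ => div_nonneg (hw0 s) hW.le, ← Finset.sum_div,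
      div_self hW.ne', ENNReal.ofReal_one])
  have hd' (s : S) : (d' s).toReal = w s / W := by
    simp only [d', PMF.ofFintype_apply]
    exact ENNReal.toReal_ofReal (div_nonneg (hw0 s) hW.le)
  refine ⟨d', ⟨w, hw, hd', hW, one_pos, ?_⟩, fun s => ⟨?_, ?_⟩⟩
  · rw [relDist, ← hu, div_one, ← hWdef]
    refine sub_le_sub_right ?_ 1
    have h1 : (1 - u)⁻¹ ≤ (1 - u) ^ (-(Fintype.card S : ℤ)) := by
      rw [zpow_neg, zpow_natCast]
      exact inv_anti₀ (by positivity)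
        (pow_le_of_le_one hv.le (by linarith) Fintype.card_ne_zero)
    have h2 : 1 ≤ (1 - u)⁻¹ := (one_le_inv₀ hv).2 (by linarith)
    refine max_le (by linarith) (le_trans ?_ h1)
    rw [one_div]
    exact inv_anti₀ hv hW1
  · rw [hd', le_div_iff₀ hW]
    refine le_trans ?_ (hw1 s)
    exact mul_le_of_le_one_right (mul_nonneg hv.le ENNReal.toReal_nonneg) hW2
  · rw [hd', mul_div_assoc', div_le_iff₀ hW, mul_comm]
    exact mul_le_mul (hw2 s) hW1 hv.le ENNReal.toReal_nonneg

end Rounding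

/-! ### The Markov chain of a profile and its expected payoffs -/

namespace StochasticGame

open Filter Topology Matrix

variable {V P : Type*}

/-- The payoff of player `i` at the terminal vertices, extended by `0`. -/
noncomputable def terminalPayoff (G : StochasticGame V P) (i : P) (v : V) : ℝ := by
  classical exact if h : G.IsTerminal v then (G.payoff ⟨v, h⟩ i : ℝ) else 0

/-- The transition matrix of the Markov chain induced by a profile. -/
noncomputable def transition (G : StochasticGame V P) (σ : G.Profile) : Matrix V V ℝ :=
  fun v w => (G.step σ v w).toReal

theorem terminalPayoff_nonneg (G : StochasticGame V P) (i : P) : 0 ≤ G.terminalPayoff i := by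
  intro v
  unfold terminalPayoff
  split_ifs with h
  · exact (G.payoff ⟨v, h⟩ i).2.1
  · exact le_rfl

theorem terminalPayoff_le_one (G : StochasticGame V P) (i : P) : G.terminalPayoff i ≤ 1 := by
  intro v
  unfold terminalPayoff
  split_ifs with h
  · exact (G.payoff ⟨v, h⟩ i).2.2
  · exact zero_le_one

theorem terminalPayoff_of_not_isTerminal (G : StochasticGame V P) (i : P) {v : V}
    (h : ¬ G.IsTerminal v) : G.terminalPayoff i v = 0 := by
  simp [terminalPayoff, h]

theorem step_of_isTerminal (G : StochasticGame V P) (σ : G.Profile) {v : V}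
    (h : G.IsTerminal v) : G.step σ v = PMF.pure v := by
  simp only [IsTerminal] at h
  simp [step, h]

/-- Two profiles are `δ`-close if all their probabilities agree up to a factor of `1 - δ`. -/
def IsCloseProfile (G : StochasticGame V P) (δ : ℝ) (σ τ : G.Profile) : Prop :=
  ∀ i v w, (1 - δ) * (σ i v w).toReal ≤ (τ i v w).toReal ∧
    (1 - δ) * (τ i v w).toReal ≤ (σ i v w).toReal

theorem IsCloseProfile.symm {G : StochasticGame V P} {δ : ℝ} {σ τ : G.Profile}
    (h : G.IsCloseProfile δ σ τ) : G.IsCloseProfile δ τ σ :=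
  fun i v w => (h i v w).symm

theorem IsCloseProfile.deviate {G : StochasticGame V P} {δ : ℝ} (hδ : 0 ≤ δ) {σ τ : G.Profile}
    (h : G.IsCloseProfile δ σ τ) (i : P) (ρ : G.Strategy i) :
    G.IsCloseProfile δ (G.deviate σ i ρ) (G.deviate τ i ρ) := by
  classical
  intro j v w
  rcases eq_or_ne j i with rfl | hj
  · have : (1 - δ) * (ρ v w).toReal ≤ (ρ v w).toReal :=
      mul_le_of_le_one_left ENNReal.toReal_nonneg (by linarith)
    simpa [StochasticGame.deviate] using this
  · simpa [StochasticGame.deviate, hj] using h j v w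

theorem _root_.PMF.map_val_apply {α : Type*} {p : α → Prop} (d : PMF {a // p a}) {w : α}
    (h : p w) : d.map Subtype.val w = d ⟨w, h⟩ := by
  rw [PMF.map_apply, tsum_eq_single ⟨w, h⟩]
  · simp
  · rintro ⟨b, hb⟩ hne
    exact if_neg fun hbw => hne (Subtype.ext hbw.symm)

theorem _root_.PMF.map_val_apply_of_not {α : Type*} {p : α → Prop} (d : PMF {a // p a}) {w : α}
    (h : ¬ p w) : d.map Subtype.val w = 0 := by
  rw [PMF.map_apply, ENNReal.tsum_eq_zero]
  rintro ⟨b, hb⟩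
  exact if_neg (by rintro rfl; exact h hb)

/-- Only rows of non-terminal player vertices can change. Their terminal payoff is `0`, as the row
perturbation bound requires. -/
theorem IsCloseProfile.transition {G : StochasticGame V P} {δ : ℝ} {σ τ : G.Profile}
    (h : G.IsCloseProfile δ σ τ) (v : V) :
    G.transition τ v = G.transition σ v ∨ ¬ G.IsTerminal v ∧
      ∀ w, (1 - δ) * G.transition σ v w ≤ G.transition τ v w := by
  by_cases hv : ∃ w, G.graph.Adj v w
  · unfold StochasticGame.transition step
    simp only [hv, dite_true]
    split
    · exact .inl rfl
    · rename_i i ho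
      refine .inr ⟨not_not.2 hv, fun w => ?_⟩
      by_cases hw : G.graph.Adj v w
      · rw [PMF.map_val_apply _ hw, PMF.map_val_apply _ hw]
        exact (h i ⟨v, ho, hv⟩ ⟨w, hw⟩).1
      · rw [PMF.map_val_apply_of_not _ hw, PMF.map_val_apply_of_not _ hw]
        simp
  · left
    funext w
    simp only [StochasticGame.transition, step_of_isTerminal G _ hv]

section Payoff

variable [Fintype V]

theorem transition_mem_rowStochastic [DecidableEq V] (G : StochasticGame V P) (σ : G.Profile) :
    G.transition σ ∈ rowStochastic ℝ V := by
  refine ⟨fun v w => ENNReal.toReal_nonneg, funext fun v => ?_⟩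
  simp only [mulVec, dotProduct, Pi.one_apply, mul_one, transition]
  exact PMF.sum_toReal _

theorem terminalPayoff_le_transition_mulVec (G : StochasticGame V P) (σ : G.Profile) (i : P) :
    G.terminalPayoff i ≤ G.transition σ *ᵥ G.terminalPayoff i := by
  classical
  intro v
  by_cases h : G.IsTerminal v
  · refine le_of_eq ?_
    simp [mulVec, dotProduct, transition, step_of_isTerminal G σ h, PMF.pure_apply, apply_ite]
  · rw [terminalPayoff_of_not_isTerminal G i h]
    exact Finset.sum_nonneg fun w _ =>
      mul_nonneg ENNReal.toReal_nonneg (G.terminalPayoff_nonneg i w)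

variable [MeasurableSpace V] [DiscreteMeasurableSpace V]

instance (G : StochasticGame V P) (σ : G.Profile) : IsProbabilityMeasure (G.playMeasure σ) := by
  unfold playMeasure
  infer_instance

theorem ae_playMeasure_zero (G : StochasticGame V P) (σ : G.Profile) :
    ∀ᵐ ω ∂G.playMeasure σ, ω 0 = G.init := by
  have h : (G.playMeasure σ).map (Preorder.frestrictLe (π := fun _ => V) 0) =
      (Measure.dirac G.init).map (MeasurableEquiv.piUnique _).symm := by
    rw [playMeasure, Kernel.trajMeasure, Measure.map_comp _ _ (by fun_prop),
      Kernel.traj_map_frestrictLe, Kernel.partialTraj_self, Measure.id_comp]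
  have h0 : ∀ᵐ x ∂(G.playMeasure σ).map (Preorder.frestrictLe (π := fun _ => V) 0),
      x ⟨0, Finset.mem_Iic.2 le_rfl⟩ = G.init := by
    rw [h]
    refine (ae_map_iff (MeasurableEquiv.measurable _).aemeasurable
      ((MeasurableSet.singleton G.init).preimage (measurable_pi_apply _))).2 ?_
    refine (ae_dirac_iff (a := G.init) ?_).2 rfl
    exact Measurable.of_discrete (f := fun x : V => x) (MeasurableSet.singleton G.init)
  exact ae_of_ae_map (by fun_prop) h0

/-- The Markov property, read off from the composition-product description of the trajectory
measure. -/
theorem playMeasure_succ (G : StochasticGame V P) (σ : G.Profile) (k : ℕ) (v w : V) :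
    G.playMeasure σ {ω | ω k = v ∧ ω (k + 1) = w} =
      G.playMeasure σ {ω | ω k = v} * G.step σ v w := by
  have hs : MeasurableSet {h : (j : Finset.Iic k) → V | h ⟨k, Finset.mem_Iic.2 le_rfl⟩ = v} :=
    (MeasurableSet.singleton v).preimage (measurable_pi_apply _)
  have key := congrArg (fun μ => μ ({h : (j : Finset.Iic k) → V |
      h ⟨k, Finset.mem_Iic.2 le_rfl⟩ = v} ×ˢ {w}))
    (Kernel.map_frestrictLe_trajMeasure_compProd_eq_map_trajMeasure (X := fun _ => V)
      (μ₀ := Measure.dirac G.init) (κ := G.stepKernel σ) (a := k))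
  beta_reduce at key
  rw [Measure.compProd_apply_prod hs (.singleton w), Measure.map_apply (by fun_prop)
    (hs.prod (.singleton w)), setLIntegral_congr_fun (g := fun _ => G.step σ v w) hs] at key
  · rw [setLIntegral_const, Measure.map_apply (by fun_prop) hs, mul_comm] at key
    exact key.symm
  · intro h hh
    have hh' : h ⟨k, Finset.mem_Iic.2 le_rfl⟩ = v := hh
    change (G.step σ (h ⟨k, Finset.mem_Iic.2 le_rfl⟩)).toMeasure {w} = _
    rw [hh', PMF.toMeasure_apply_singleton _ _ (.singleton w)]

theorem integral_eval_eq_sum (G : StochasticGame V P) (σ : G.Profile) (φ : V → ℝ) (k : ℕ) :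
    ∫ ω, φ (ω k) ∂G.playMeasure σ = ∑ v, (G.playMeasure σ).real {ω | ω k = v} * φ v := by
  have hk : Measurable fun ω : ℕ → V => ω k := measurable_pi_apply k
  have : IsProbabilityMeasure ((G.playMeasure σ).map fun ω => ω k) :=
    Measure.isProbabilityMeasure_map hk.aemeasurable
  rw [← integral_map (φ := fun ω : ℕ → V => ω k) hk.aemeasurable
    (Measurable.of_discrete (f := φ)).aestronglyMeasurable, integral_fintype .of_finite]
  refine Finset.sum_congr rfl fun v _ => ?_
  rw [map_measureReal_apply hk (.singleton v)]
  rfl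

theorem integral_eval_succ (G : StochasticGame V P) (σ : G.Profile) (φ : V → ℝ) (k : ℕ) :
    ∫ ω, φ (ω (k + 1)) ∂G.playMeasure σ =
      ∫ ω, (G.transition σ *ᵥ φ) (ω k) ∂G.playMeasure σ := by
  have h (w : V) : (G.playMeasure σ).real {ω | ω (k + 1) = w} =
      ∑ v, (G.playMeasure σ).real {ω | ω k = v} * G.transition σ v w := by
    have hU : {ω : ℕ → V | ω (k + 1) = w} = ⋃ v, {ω | ω k = v ∧ ω (k + 1) = w} := by
      ext ω; simp
    rw [hU, measureReal_def, measure_iUnion, tsum_fintype, ENNReal.toReal_sum]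
    · refine Finset.sum_congr rfl fun v _ => ?_
      rw [playMeasure_succ, ENNReal.toReal_mul]
      rfl
    · exact fun v _ => measure_ne_top _ _
    · intro v v' hv
      exact Set.disjoint_left.2 fun ω h1 h2 => hv (h1.1.symm.trans h2.1)
    · intro v
      exact ((MeasurableSet.singleton v).preimage (measurable_pi_apply k)).inter
        ((MeasurableSet.singleton w).preimage (measurable_pi_apply (k + 1)))
  rw [integral_eval_eq_sum, integral_eval_eq_sum]
  simp only [h, mulVec, dotProduct, Finset.mul_sum, Finset.sum_mul, mul_assoc]
  exact Finset.sum_comm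

theorem integral_eval [DecidableEq V] (G : StochasticGame V P) (σ : G.Profile) (φ : V → ℝ)
    (k : ℕ) : ∫ ω, φ (ω k) ∂G.playMeasure σ = ((G.transition σ ^ k) *ᵥ φ) G.init := by
  induction k generalizing φ with
  | zero =>
    rw [integral_congr_ae (g := fun _ => φ G.init)]
    · simp
    · filter_upwards [G.ae_playMeasure_zero σ] with ω hω
      rw [hω]
  | succ k ih => rw [integral_eval_succ, ih, mulVec_mulVec, ← pow_succ]

/-- Almost surely no transition of probability `0` occurs, so a play stays at the first terminal
vertex it meets and the sequence is eventually constant; without such a vertex it is constantly `0`.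
-/
theorem ae_tendsto_terminalPayoff (G : StochasticGame V P) (σ : G.Profile) (i : P) :
    ∀ᵐ ω ∂G.playMeasure σ,
      Tendsto (fun k => G.terminalPayoff i (ω k)) atTop (𝓝 (G.playPayoff i ω)) := by
  classical
  have hstep : ∀ᵐ ω ∂G.playMeasure σ, ∀ k v w, G.step σ v w = 0 →
      ¬ (ω k = v ∧ ω (k + 1) = w) := by
    simp only [ae_all_iff]
    intro k v w h
    rw [ae_iff]
    simp only [not_not]
    rw [playMeasure_succ, h, mul_zero]
  filter_upwards [hstep] with ω hω
  have hstay (k : ℕ) (h : G.IsTerminal (ω k)) : ω (k + 1) = ω k := by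
    by_contra hne
    refine hω k _ _ ?_ ⟨rfl, rfl⟩
    rw [G.step_of_isTerminal σ h, PMF.pure_apply, if_neg hne]
  unfold playPayoff
  split_ifs with h
  · have hconst (n : ℕ) (hn : Nat.find h ≤ n) : ω n = ω (Nat.find h) := by
      induction n, hn using Nat.le_induction with
      | base => rfl
      | succ n hn ih => rw [hstay n (ih ▸ Nat.find_spec h), ih]
    refine tendsto_const_nhds.congr' ?_
    filter_upwards [eventually_ge_atTop (Nat.find h)] with n hn
    rw [hconst n hn, terminalPayoff, dif_pos (Nat.find_spec h)]
  · push Not at h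
    simp [terminalPayoff_of_not_isTerminal G i (h _)]

theorem tendsto_integral_playPayoff [DecidableEq V] (G : StochasticGame V P) (σ : G.Profile)
    (i : P) :
    Tendsto (fun k => ((G.transition σ ^ k) *ᵥ G.terminalPayoff i) G.init) atTop
      (𝓝 (∫ ω, G.playPayoff i ω ∂G.playMeasure σ)) := by
  simp only [← integral_eval]
  refine tendsto_integral_of_dominated_convergence (fun _ => 1) (fun k => ?_)
    (integrable_const _) (fun k => ?_) (G.ae_tendsto_terminalPayoff σ i)
  · exact ((Measurable.of_discrete (f := G.terminalPayoff i)).comp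
      (measurable_pi_apply k)).aestronglyMeasurable
  · refine .of_forall fun ω => ?_
    rw [Real.norm_of_nonneg (G.terminalPayoff_nonneg i _)]
    exact G.terminalPayoff_le_one i _

end Payoff

variable [Fintype V]

/-- The expected payoff is the value at the initial vertex of the least superharmonic majorant
of the terminal payoffs. -/
theorem exists_isLeast_expectedPayoff (G : StochasticGame V P) (σ : G.Profile) (i : P) :
    ∃ f, IsLeast (superharmonicMajorants (G.transition σ) (G.terminalPayoff i)) f ∧
      G.expectedPayoff σ i = f G.init := by
  classical
  obtain ⟨f, hf, hft⟩ := exists_isLeast_superharmonicMajorants (G.transition_mem_rowStochastic σ)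
    (G.terminalPayoff_le_transition_mulVec σ i) (G.terminalPayoff_le_one i)
  let _ : MeasurableSpace V := ⊤
  exact ⟨f, hf, tendsto_nhds_unique (G.tendsto_integral_playPayoff σ i)
    (tendsto_pi_nhds.1 hft G.init)⟩

theorem expectedPayoff_mem_Icc (G : StochasticGame V P) (σ : G.Profile) (i : P) :
    G.expectedPayoff σ i ∈ Set.Icc 0 1 := by
  classical
  obtain ⟨f, hf, h⟩ := G.exists_isLeast_expectedPayoff σ i
  rw [h]
  exact ⟨(G.terminalPayoff_nonneg i _).trans (hf.1.1 _),
    hf.2 (one_mem_superharmonicMajorants (G.transition_mem_rowStochastic σ)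
      (G.terminalPayoff_le_one i)) _⟩

end StochasticGame

/-! ### Payoffs of close profiles and the rounded equilibrium -/

namespace StochasticGame

variable {V P : Type*} [Fintype V]

/-- Profiles whose probabilities agree up to a factor of `1 - δ` have expected payoffs that differ
by at most `2 * card V * δ`. -/
theorem IsCloseProfile.expectedPayoff_le {G : StochasticGame V P} {δ : ℝ} (hδ0 : 0 ≤ δ)
    (hδ1 : δ < 1) {σ τ : G.Profile} (h : G.IsCloseProfile δ σ τ) (i : P) :
    G.expectedPayoff τ i ≤ G.expectedPayoff σ i + 2 * Fintype.card V * δ := by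
  classical
  have hd : 0 < 1 - δ := by linarith
  obtain ⟨f, hf, hfe⟩ := G.exists_isLeast_expectedPayoff σ i
  obtain ⟨g, hg, hge⟩ := G.exists_isLeast_expectedPayoff τ i
  have key := isLeast_superharmonicMajorants_le (c := (1 - δ)⁻¹)
    (G.transition_mem_rowStochastic σ) (G.transition_mem_rowStochastic τ)
    (G.terminalPayoff_nonneg i) (G.terminalPayoff_le_one i)
    (G.terminalPayoff_le_transition_mulVec σ i) ((one_le_inv₀ hd).2 (by linarith))
    (fun s => ?_) hf hg G.init
  · rw [Pi.smul_apply, smul_eq_mul, ← hfe, ← hge, inv_pow, ← div_eq_inv_mul,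
      le_div_iff₀ (by positivity)] at key
    -- Bernoulli: `(1 - δ) ^ (2 * n) ≥ 1 - 2 * n * δ` turns the multiplicative bound into an
    -- additive one.
    have hb := one_add_mul_le_pow (a := -δ) (by linarith) (2 * Fintype.card V)
    rw [← sub_eq_add_neg] at hb
    push_cast at hb
    obtain ⟨h0, h1⟩ := G.expectedPayoff_mem_Icc τ i
    have h2 := mul_le_mul_of_nonneg_left hb h0
    have h3 : G.expectedPayoff τ i * (2 * Fintype.card V * δ) ≤ 2 * Fintype.card V * δ :=
      mul_le_of_le_one_left (by positivity) h1
    linarith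
  · rcases h.transition s with hs | ⟨hs, h1⟩
    · exact .inl hs
    rcases h.symm.transition s with hs' | ⟨-, h2⟩
    · exact .inl hs'.symm
    refine .inr ⟨G.terminalPayoff_of_not_isTerminal i hs, fun w => ?_, fun w => ?_⟩
    · rw [← div_eq_inv_mul, le_div_iff₀' hd]; exact h2 w
    · rw [← div_eq_inv_mul, le_div_iff₀' hd]; exact h1 w

end StochasticGame

theorem mainTheorem5 {V P : Type*} [Fintype V] [Finite P] (G : StochasticGame V P)
    (x y : P → ℚ) (ℓ : ℕ) (hℓ : 1000 * Fintype.card V ^ 2 ≤ ℓ)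
    (hNE : ∃ σ : G.Profile, G.IsConstrainedNash x y σ) :
    ∃ σ' : G.Profile,
      G.IsEpsConstrainedNash x y (32 * (Fintype.card V : ℝ) ^ 2 * (2 : ℝ) ^ (-(ℓ : ℤ))) σ' ∧
      G.IsFloatProfile ℓ σ' := by
  classical
  obtain ⟨σ, hσ, hxy⟩ := hNE
  have hV : 1 ≤ Fintype.card V := Fintype.card_pos_iff.2 ⟨G.init⟩
  have hℓ2 : 2 ≤ ℓ := by nlinarith
  choose σ' hfl hcl using fun (i : P) (v : G.Controlled i) =>
    exists_floatDistribution_approx hℓ2 (σ i v)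
  set δ : ℝ := 2 ^ (1 - (ℓ : ℤ)) with hδ
  have hδ0 : 0 ≤ δ := by positivity
  have hδ1 : δ < 1 := zpow_lt_one_of_neg₀ one_lt_two (by omega)
  have hclose : G.IsCloseProfile δ σ σ' := hcl
  -- Two payoff comparisons cost `4 * n * δ = 8 * n * 2 ^ (-ℓ)`, well within the allowed error since
  -- `n ≥ 1`.
  have hε : 4 * Fintype.card V * δ ≤
      32 * (Fintype.card V : ℝ) ^ 2 * (2 : ℝ) ^ (-(ℓ : ℤ)) := by
    have h1 : δ = 2 * (2 : ℝ) ^ (-(ℓ : ℤ)) := by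
      rw [hδ, sub_eq_add_neg, zpow_add₀ two_ne_zero, zpow_one]
    have h2 : (1 : ℝ) ≤ Fintype.card V := by exact_mod_cast hV
    have h3 : 8 * (Fintype.card V : ℝ) ≤ 32 * (Fintype.card V : ℝ) ^ 2 := by nlinarith
    calc 4 * Fintype.card V * δ = 8 * (Fintype.card V : ℝ) * (2 : ℝ) ^ (-(ℓ : ℤ)) := by
          rw [h1]; ring
      _ ≤ _ := by gcongr
  have hc0 : 0 ≤ Fintype.card V * δ := by positivity
  have hle i := hclose.expectedPayoff_le hδ0 hδ1 i
  have hge i := hclose.symm.expectedPayoff_le hδ0 hδ1 i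
  refine ⟨σ', ⟨fun i τ => ?_, fun i => ⟨?_, ?_⟩⟩, fun i v => ?_⟩
  -- Compare the deviations from `σ'` and `σ`, use the equilibrium property of `σ`, then return from
  -- `σ` to `σ'`.
  · have h1 := (hclose.deviate hδ0 i τ).expectedPayoff_le hδ0 hδ1 i
    linarith [hσ i τ, hge i]
  · linarith [(hxy i).1, hge i]
  · linarith [(hxy i).2, hle i]
  · convert hfl i v
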